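/- There are absolute constants $p, c > 0$ such that the following holds for every number of qubits $n \ge 1$ and every even $M \ge 2$. Let $Z_n = \mathbb{1} \otimes \cdots \otimes \mathbb{1} \otimes Z$ be the Pauli-$Z$ operator on the $n$-th qubit, let $U_1, \ldots, U_{M/2}$ be independent Haar-random elements of the unitary group $\mathbb{U}(2^n)$, and put $O_i = U_i Z_n U_i^\dagger$ and $O_{M/2+i} = -U_i Z_n U_i^\dagger$ for $1 \le i \le M/2$. A learning algorithm without quantum memory that uses $T$ copies of an unknown $n$-qubit state $\rho$ measures the copies one at a time. For each copy it selects a POVM $\{F_s\}_s$ (finitely or countably many positive semidefinite operators $F_s$ with $\sum_s F_s = \mathbb{1}$), which may depend on all previous outcomes, and observes outcome $s$ with probability $\operatorname{Tr}(F_s \rho)$. After the $T$ measurements it outputs a (possibly randomized) prediction that depends on all the outcomes. The POVMs and the prediction rule may depend on $O_1, \ldots, O_M$. With probability at least $p$ over $U_1, \ldots, U_{M/2}$, the following is true for all $0 < \epsilon < 0.29$ and all $T \ge 0$ simultaneously: if some learning algorithm without quantum memory that uses $T$ copies outputs, for every $n$-qubit state $\rho$, with probability at least $2/3$, numbers $v_1,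 \ldots, v_M$ with $|v_x - \operatorname{Tr}(O_x \rho)| \le \epsilon$ for all $x = 1, \ldots, M$, then $$T \ \ge\ c \cdot \frac{\min\left(M/\log M,\ 2^n\right)}{\epsilon^2}.$$ -/

import Mathlib

open MeasureTheory Matrix
open scoped ENNReal ComplexOrder

noncomputable section

/-- Labels of the computational basis of `n` qubits: matrices indexed by `Qubits n` are the
operators on the `n`-fold tensor power of `ℂ²`, a space of dimension `2 ^ n`. -/
abbrev Qubits (n : ℕ) : Type := Fin n → Fin 2

/-- Operators on `n` qubits. -/
abbrev QubitOp (n : ℕ) : Type := Matrix (Qubits n) (Qubits n) ℂ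

/-- `ρ` is an `n`-qubit state (a density matrix). -/
def IsQubitState {n : ℕ} (ρ : QubitOp n) : Prop := ρ.PosSemidef ∧ ρ.trace = 1

/-! ### Haar measure on the unitary group -/

/-- The unitary group `U(2 ^ n)`. -/
abbrev QubitUnitary (n : ℕ) : Type := Matrix.unitaryGroup (Qubits n) ℂ

instance instCompactSpaceQubitUnitary (n : ℕ) : CompactSpace (QubitUnitary n) := by
  refine (isCompact_iff_compactSpace (s := (Matrix.unitaryGroup (Qubits n) ℂ : Set (QubitOp n)))).mp ?_
  have hK : IsCompact (Set.pi Set.univ fun _ : Qubits n =>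
      Set.pi Set.univ fun _ : Qubits n => Metric.closedBall (0 : ℂ) 1) :=
    isCompact_univ_pi fun _ => isCompact_univ_pi fun _ => isCompact_closedBall 0 1
  refine IsCompact.of_isClosed_subset (s := (Set.pi Set.univ fun _ : Qubits n =>
      Set.pi Set.univ fun _ : Qubits n => Metric.closedBall (0 : ℂ) 1 : Set (QubitOp n))) hK ?_ ?_
  · have : (Matrix.unitaryGroup (Qubits n) ℂ : Set (QubitOp n)) = {A | star A * A = 1} := by
      ext A
      exact Matrix.mem_unitaryGroup_iff'
    rw [this]
    exact isClosed_eq (by fun_prop) continuous_const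
  · intro A hA i _ j _
    simpa using entry_norm_bound_of_unitary hA i j

instance instMeasurableSpaceQubitUnitary (n : ℕ) : MeasurableSpace (QubitUnitary n) :=
  borel _

instance instBorelSpaceQubitUnitary (n : ℕ) : BorelSpace (QubitUnitary n) := ⟨rfl⟩

/-- The Haar probability measure on `U(2 ^ n)`. -/
def haarUnitary (n : ℕ) : Measure (QubitUnitary n) := Measure.haarMeasure ⊤

instance instIsProbabilityMeasureHaarUnitary (n : ℕ) :
    IsProbabilityMeasure (haarUnitary n) :=
  ⟨Measure.haarMeasure_self (K₀ := (⊤ : TopologicalSpace.PositiveCompacts (QubitUnitary n)))⟩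

/-! ### The random observables -/

/-- The Pauli matrix `Z`. -/
def pauliZ : Matrix (Fin 2) (Fin 2) ℂ := !![1, 0; 0, -1]

/-- `1 ⊗ ⋯ ⊗ Z ⊗ ⋯ ⊗ 1`: the Pauli `Z` operator on qubit `j`, as the tensor product whose factor
at `j` is `Z` and whose other factors are identities. -/
def pauliZAt {n : ℕ} (j : Fin n) : QubitOp n :=
  Matrix.of fun x y => ∏ k, (if k = j then pauliZ else 1) (x k) (y k)

/-- Explicitly, the operator is diagonal with entries `(-1) ^ x j`. -/
theorem pauliZAt_eq_diagonal {n : ℕ} (j : Fin n) : pauliZAt j =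
      Matrix.diagonal (fun x => if x j = 0 then 1 else -1) := by
  ext x y
  by_cases h : x = y
  · subst h
    simp only [pauliZAt, Matrix.of_apply, Matrix.diagonal_apply_eq]
    rw [Finset.prod_eq_single j]
    · rcases (show x j = 0 ∨ x j = 1 by omega) with h | h <;> simp [pauliZ, h]
    · intro k _ hk; simp [hk]
    · simp
  · rw [Matrix.diagonal_apply_ne _ h]
    obtain ⟨k, hk⟩ := Function.ne_iff.mp h
    simp only [pauliZAt, Matrix.of_apply]
    apply Finset.prod_eq_zero (Finset.mem_univ k)
    by_cases hkj : k = j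
    · subst hkj
      rcases (show (x k = 0 ∧ y k = 1) ∨ (x k = 1 ∧ y k = 0) by omega) with h | h <;> simp [pauliZ, h]
    · simp [hkj, hk]

/-- The Pauli `Z` operator on the last of `n` qubits. -/
def pauliZLast {n : ℕ} (hn : 0 < n) : QubitOp n := pauliZAt ⟨n - 1, Nat.sub_one_lt_of_lt hn⟩

/-- The `M = 2 m` observables `U i * Z * (U i)ᴴ` and their negatives, for `i : Fin m`. -/
def signedObservables {n m : ℕ} (hn : 0 < n) (U : Fin m → QubitUnitary n) :
    Fin m ⊕ Fin m → QubitOp n :=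
  Sum.elim (fun i => (U i : QubitOp n) * pauliZLast hn * (U i : QubitOp n)ᴴ)
    (fun i => -((U i : QubitOp n) * pauliZLast hn * (U i : QubitOp n)ᴴ))

/-! ### Learning algorithms without quantum memory -/

/-- A POVM with countably many outcomes. A POVM with finitely many outcomes is extended by zero
operators. -/
structure POVM (n : ℕ) where
  /-- The operator of each outcome. -/
  elem : ℕ → QubitOp n
  posSemidef : ∀ s, (elem s).PosSemidef
  hasSum_one : HasSum elem 1

/-- The probability of outcome `s` when the POVM `F` is measured on the state `ρ`. -/
def POVM.prob {n : ℕ} (F : POVM n) (ρ : QubitOp n) (s : ℕ) : ℝ := (F.elem s * ρ).trace.re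

/-- An adaptive learning algorithm without quantum memory that uses `T` copies of an unknown
`n`-qubit state and predicts a family of real numbers indexed by `ι`. A copy is measured with a
POVM that depends on all previous outcomes (`povm t h` is applied to copy number `t`, counted from
`0`, after the outcomes `h`; only `t < T` is used). The final prediction depends on all the
outcomes; it is allowed to be randomized. -/
structure MemorylessLearner (n T : ℕ) (ι : Type) where
  povm : (t : ℕ) → (Fin t → ℕ) → POVM n
  predict : (Fin T → ℕ) → ProbabilityMeasure (ι → ℝ)

/-- The probability that the first `t` outcomes are `h` when the unknown state is `ρ`: this is the
probability of a node at depth `t` of the tree of the algorithm. -/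
def MemorylessLearner.nodeProb {n T : ℕ} {ι : Type} (A : MemorylessLearner n T ι)
    (ρ : QubitOp n) : (t : ℕ) → (Fin t → ℕ) → ℝ
  | 0, _ => 1
  | t + 1, h =>
      A.nodeProb ρ t (Fin.init h) * (A.povm t (Fin.init h)).prob ρ (h (Fin.last t))

/-- The probability, over all the measurement outcomes and the prediction, that for the unknown
state `ρ` every `Tr(O x * ρ)` is predicted to error at most `ε`. -/
def MemorylessLearner.successProb {n T : ℕ} {ι : Type} (A : MemorylessLearner n T ι)
    (O : ι → QubitOp n) (ε : ℝ) (ρ : QubitOp n) : ℝ≥0∞ :=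
  ∑' h : Fin T → ℕ, ENNReal.ofReal (A.nodeProb ρ T h) *
    (A.predict h : Measure (ι → ℝ)) {v | ∀ x, |v x - (O x * ρ).trace.re| ≤ ε}

/-- The algorithm performs shadow tomography for the observables `O`: for every unknown state,
with probability at least `2 / 3` all the expectation values are predicted to error at most `ε`. -/
def MemorylessLearner.Predicts {n T : ℕ} {ι : Type} (A : MemorylessLearner n T ι)
    (O : ι → QubitOp n) (ε : ℝ) : Prop :=
  ∀ ρ : QubitOp n, IsQubitState ρ → 2 / 3 ≤ A.successProb O ε ρ

end

/-!
The lower bound compares two hypotheses about the unknown state: the maximally mixed state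
`1 / 2 ^ n`, and the state `(1 + 3 ε O x) / 2 ^ n` for a uniformly random index `x`. All observables
have expectation value `0` in the first state and `O x` has the value `3 ε` in the second, so a
successful learner tells the two hypotheses apart (`MemorylessLearner.Predicts.likelihoodRatio_le`).

Fix a sequence of outcomes. An outcome with operator `F` multiplies the likelihood of the
alternative `x` by `1 + 3 ε Tr (F (O x)) / Tr F` relative to the maximally mixed state. The
observables come in pairs `± O`, so in the geometric mean over `x` the linear terms cancel and only
`ε ² Tr (F O) ² / (Tr F) ²`, averaged over the observables, is lost per measurement
(`MemorylessLearner.exp_neg_mul_nodeProb_le`). By the inequality of arithmetic and geometric means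
the same lower bound holds for the uniform mixture of the alternatives, *for every* sequence of
outcomes. Hence `T` is at least a constant times `m / (ε ² K)`, whenever `∑ i, ⟨φ, O i φ⟩ ² ≤ K` for
all unit vectors `φ` (`log_two_le_of_predicts`).

It remains to show that `K` can be a multiple of `1 + m / 2 ^ n` with probability at least `1 / 2`
(`half_le_haarPi_spreadUnitaries`). For a fixed unit vector `φ` and a Haar-random `U` the number
`X = ⟨φ, U Z Uᴴ φ⟩` is subgaussian with variance proxy `4 / 2 ^ n`
(`integral_exp_mul_qform_rotatedZ_le`): integrating `exp (-‖z‖ ² + s ⟨z, U Z Uᴴ z⟩)` over `z` and `U`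
in the two possible orders yields the identity `E (1 - s X) ^ (-2 ^ n) = det (1 - s Z)⁻¹`, from
which the bound on the moment generating function follows. The Chernoff bound and a union bound over
nets of the unit spheres of `ℂ ^ (2 ^ n)` and `ℝ ^ m` then control all `φ` at once
(`norm_qvec_le_of_net`). No logarithm of `m` is lost, so the result is slightly stronger than
needed.
-/

/-! ### Quadratic forms and Gaussian integrals -/

/-- The real quadratic form `z ↦ Re ⟨z, A z⟩` of a complex matrix. -/
noncomputable def qform {ι : Type*} [Fintype ι] (A : Matrix ι ι ℂ) (z : ι → ℂ) : ℝ :=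
  (star z ⬝ᵥ (A *ᵥ z)).re

section QuadraticForm

variable {ι : Type*} [Fintype ι]

theorem qform_diagonal [DecidableEq ι] (a : ι → ℝ) (z : ι → ℂ) :
    qform (Matrix.diagonal fun x => (a x : ℂ)) z = ∑ x, a x * ‖z x‖ ^ 2 := by
  simp only [qform, dotProduct, mulVec_diagonal, Complex.re_sum, Pi.star_apply, RCLike.star_def]
  refine Finset.sum_congr rfl fun x _ => ?_
  rw [mul_left_comm, ← Complex.normSq_eq_conj_mul_self, ← Complex.ofReal_mul, Complex.ofReal_re,
    Complex.normSq_eq_norm_sq]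

theorem qform_one [DecidableEq ι] (z : ι → ℂ) :
    qform (1 : Matrix ι ι ℂ) z = ∑ x, ‖z x‖ ^ 2 := by
  simpa using qform_diagonal (fun _ : ι => (1 : ℝ)) z

theorem qform_conj (A B : Matrix ι ι ℂ) (z : ι → ℂ) :
    qform (B * A * Bᴴ) z = qform A (Bᴴ *ᵥ z) := by
  simp only [qform, star_mulVec, conjTranspose_conjTranspose, ← mulVec_mulVec,
    dotProduct_mulVec, vecMul_vecMul]

theorem qform_smul_vec (A : Matrix ι ι ℂ) (c : ℝ) (z : ι → ℂ) :
    qform A (c • z) = c ^ 2 * qform A z := by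
  rw [qform, star_smul, mulVec_smul, smul_dotProduct, dotProduct_smul, smul_smul,
    Complex.smul_re, star_trivial, smul_eq_mul, sq, qform]

theorem continuous_qform (A : Matrix ι ι ℂ) : Continuous (qform A) := by
  unfold qform
  exact Complex.continuous_re.comp
    (Continuous.dotProduct continuous_star
      (Continuous.matrix_mulVec continuous_const continuous_id))

/-- A unitary matrix preserves the Euclidean norm. -/
theorem sum_norm_sq_unitary_mulVec [DecidableEq ι] {B : Matrix ι ι ℂ}
    (hB : B ∈ Matrix.unitaryGroup ι ℂ) (z : ι → ℂ) :
    ∑ x, ‖(B *ᵥ z) x‖ ^ 2 = ∑ x, ‖z x‖ ^ 2 := by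
  have h := qform_conj (1 : Matrix ι ι ℂ) Bᴴ z
  rw [conjTranspose_conjTranspose, mul_one, ← star_eq_conjTranspose,
    Matrix.mem_unitaryGroup_iff'.1 hB, qform_one, qform_one] at h
  exact h.symm

/-- The unitary group acts transitively on the unit sphere. -/
theorem exists_unitary_mulVec_eq [DecidableEq ι] {v w : ι → ℂ}
    (hv : ∑ x, ‖v x‖ ^ 2 = 1) (hw : ∑ x, ‖w x‖ ^ 2 = 1) :
    ∃ B : Matrix.unitaryGroup ι ℂ, (B : Matrix ι ι ℂ) *ᵥ v = w := by
  have hne : Nonempty ι := by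
    by_contra h
    rw [not_nonempty_iff] at h
    simp at hv
  obtain ⟨i₀⟩ := hne
  -- every unit vector is a column of a unitary matrix
  have key : ∀ u : ι → ℂ, ∑ x, ‖u x‖ ^ 2 = 1 →
      ∃ B : Matrix.unitaryGroup ι ℂ, (B : Matrix ι ι ℂ) *ᵥ (Pi.single i₀ 1) = u := by
    intro u hu
    have hn : ‖(WithLp.toLp 2 u : EuclideanSpace ℂ ι)‖ = 1 := by
      rw [EuclideanSpace.norm_eq]; simp [hu]
    have ho : Orthonormal ℂ (({i₀} : Set ι).domRestrict
        (fun _ : ι => (WithLp.toLp 2 u : EuclideanSpace ℂ ι))) := by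
      rw [orthonormal_iff_ite]
      intro i j
      have : i = j := Subsingleton.elim _ _
      simp [this, Set.domRestrict, inner_self_eq_norm_sq_to_K, hn]
    obtain ⟨b, hb⟩ := ho.exists_orthonormalBasis_extension_of_card_eq (by simp)
    refine ⟨⟨_, (EuclideanSpace.basisFun ι ℂ).toMatrix_orthonormalBasis_mem_unitary b⟩, ?_⟩
    ext x
    simp [Module.Basis.toMatrix, hb i₀ rfl]
  obtain ⟨B, hB⟩ := key v hv
  obtain ⟨C, hC⟩ := key w hw
  refine ⟨C * B⁻¹, ?_⟩
  rw [← hB, mulVec_mulVec, ← hC]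
  congr 1
  have : C * B⁻¹ * B = C := by group
  exact congrArg Subtype.val this

end QuadraticForm

section Gaussian

variable {ι : Type*} [Fintype ι]

/-- The Gaussian integral over `ℂ ^ ι` with a diagonal form. -/
theorem lintegral_exp_neg_sum_mul_norm_sq (a : ι → ℝ) (ha : ∀ x, 0 < a x) :
    ∫⁻ z : ι → ℂ, ENNReal.ofReal (Real.exp (-∑ x, a x * ‖z x‖ ^ 2)) =
      ENNReal.ofReal (∏ x, (Real.pi / a x)) := by
  have h1 : ∀ x, ∫ z : ℂ, Real.exp (-a x * ‖z‖ ^ 2) = Real.pi / a x := fun x => by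
    rw [GaussianFourier.integral_rexp_neg_mul_sq_norm (ha x)]; simp
  have hi : ∀ x, Integrable fun z : ℂ => Real.exp (-a x * ‖z‖ ^ 2) := fun x => by
    refine Integrable.of_integral_ne_zero ?_
    rw [h1]; exact (div_pos Real.pi_pos (ha x)).ne'
  have he : ∀ z : ι → ℂ, Real.exp (-∑ x, a x * ‖z x‖ ^ 2) =
      ∏ x, Real.exp (-a x * ‖z x‖ ^ 2) := fun z => by
    rw [← Real.exp_sum, ← Finset.sum_neg_distrib]; simp
  simp only [he]
  have hint : Integrable (fun z : ι → ℂ => ∏ x, Real.exp (-a x * ‖z x‖ ^ 2)) :=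
    Integrable.fintype_prod (f := fun x (z : ℂ) => Real.exp (-a x * ‖z‖ ^ 2)) hi
  rw [← ofReal_integral_eq_lintegral_ofReal hint
    (Filter.Eventually.of_forall fun z => Finset.prod_nonneg fun x _ => (Real.exp_pos _).le)]
  rw [volume_pi, integral_fintype_prod_eq_prod (fun x (z : ℂ) => Real.exp (-a x * ‖z‖ ^ 2))]
  simp only [h1]

/-- A unitary matrix preserves Lebesgue measure on `ℂ ^ ι`: it multiplies it by a constant, which
is `1` because it preserves the standard Gaussian integral. -/
theorem measurePreserving_unitary_mulVec [DecidableEq ι] {B : Matrix ι ι ℂ}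
    (hB : B ∈ Matrix.unitaryGroup ι ℂ) :
    MeasurePreserving (fun z : ι → ℂ => B *ᵥ z) := by
  have hcont : Continuous fun z : ι → ℂ => B *ᵥ z :=
    Continuous.matrix_mulVec continuous_const continuous_id
  refine ⟨hcont.measurable, ?_⟩
  let f : (ι → ℂ) →ₗ[ℝ] (ι → ℂ) := B.mulVecLin.restrictScalars ℝ
  have hinj : Function.Injective f := by
    intro z w h
    have h' : B *ᵥ z = B *ᵥ w := h
    have := congrArg (fun v => Bᴴ *ᵥ v) h'
    simpa [mulVec_mulVec, ← star_eq_conjTranspose, Matrix.mem_unitaryGroup_iff'.1 hB] using this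
  have hdet : LinearMap.det f ≠ 0 :=
    (LinearMap.isUnit_det f
      ((Module.End.isUnit_iff f).2 ⟨hinj, LinearMap.injective_iff_surjective.1 hinj⟩)).ne_zero
  have hmap := Measure.map_linearMap_addHaar_eq_smul_addHaar
    (volume : Measure (ι → ℂ)) hdet
  change Measure.map (fun z : ι → ℂ => B *ᵥ z) volume = _ at hmap
  set c := ENNReal.ofReal |(LinearMap.det f)⁻¹|
  have hg := lintegral_exp_neg_sum_mul_norm_sq (fun _ : ι => (1 : ℝ)) (fun _ => one_pos)
  have hmeas : Measurable fun z : ι → ℂ =>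
      ENNReal.ofReal (Real.exp (-∑ x, (1 : ℝ) * ‖z x‖ ^ 2)) := by fun_prop
  have h2 := lintegral_map (μ := volume) hmeas hcont.measurable
  rw [hmap, lintegral_smul_measure] at h2
  simp only [one_mul, sum_norm_sq_unitary_mulVec hB] at h2 hg
  rw [hg] at h2
  have hpos : ENNReal.ofReal (∏ _x : ι, (Real.pi / 1)) ≠ 0 := by
    simp only [ne_eq, ENNReal.ofReal_eq_zero, not_le]
    exact Finset.prod_pos fun _ _ => by simpa using Real.pi_pos
  have hc : c = 1 := by
    have : c * ENNReal.ofReal (∏ _x : ι, (Real.pi / 1)) =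
      1 * ENNReal.ofReal (∏ _x : ι, (Real.pi / 1)) := by rw [one_mul]; exact h2
    exact (ENNReal.mul_left_inj hpos ENNReal.ofReal_ne_top).1 this
  rw [hmap, hc, one_smul]

end Gaussian

/-! ### The moment generating function of a Haar-random expectation value -/

instance instIsHaarMeasureHaarUnitary (n : ℕ) : (haarUnitary n).IsHaarMeasure :=
  Measure.isHaarMeasure_haarMeasure _

instance instSecondCountableTopologyQubitUnitary (n : ℕ) :
    SecondCountableTopology (QubitUnitary n) :=
  inferInstanceAs (SecondCountableTopology
    {A : Qubits n → Qubits n → ℂ // A ∈ Matrix.unitaryGroup (Qubits n) ℂ})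

/-- The diagonal entries of `pauliZLast`. -/
noncomputable def zSign {n : ℕ} (hn : 0 < n) (x : Qubits n) : ℝ :=
  if x ⟨n - 1, Nat.sub_one_lt_of_lt hn⟩ = 0 then 1 else -1

theorem pauliZLast_eq_diagonal {n : ℕ} (hn : 0 < n) :
    pauliZLast hn = Matrix.diagonal fun x => (zSign hn x : ℂ) := by
  rw [pauliZLast, pauliZAt_eq_diagonal]
  congr 1
  ext x
  unfold zSign
  split_ifs <;> simp

theorem abs_zSign {n : ℕ} (hn : 0 < n) (x : Qubits n) : |zSign hn x| = 1 := by
  unfold zSign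
  split_ifs <;> simp

/-- Flipping the last bit pairs the eigenvectors of `pauliZLast` for the eigenvalues `1` and
`-1`. -/
theorem exists_perm_zSign_eq_neg {n : ℕ} (hn : 0 < n) :
    ∃ e : Equiv.Perm (Qubits n), ∀ x, zSign hn (e x) = -zSign hn x := by
  set j : Fin n := ⟨n - 1, Nat.sub_one_lt_of_lt hn⟩ with hj
  have hinv : Function.Involutive fun x : Qubits n => Function.update x j (1 - x j) := by
    intro x
    ext k
    by_cases hk : k = j
    · subst hk; simp
    · simp [hk]
  refine ⟨hinv.toPerm, fun x => ?_⟩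
  simp only [Function.Involutive.coe_toPerm, zSign, ← hj, Function.update_self]
  rcases (show x j = 0 ∨ x j = 1 by omega) with h | h <;> simp [h]

theorem sum_zSign {n : ℕ} (hn : 0 < n) : ∑ x, zSign hn x = 0 := by
  obtain ⟨e, he⟩ := exists_perm_zSign_eq_neg hn
  have h := Equiv.sum_comp e (zSign hn)
  simp only [he, Finset.sum_neg_distrib] at h
  linarith

/-- The square of `det (1 - s Z)` is `(1 - s²) ^ (2 ^ n)`. -/
theorem prod_one_sub_mul_zSign_sq {n : ℕ} (hn : 0 < n) (s : ℝ) :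
    (∏ x : Qubits n, (1 - s * zSign hn x)) ^ 2 = (1 - s ^ 2) ^ 2 ^ n := by
  obtain ⟨e, he⟩ := exists_perm_zSign_eq_neg hn
  have hflip : ∏ x : Qubits n, (1 - s * zSign hn x) = ∏ x : Qubits n, (1 + s * zSign hn x) := by
    rw [← Equiv.prod_comp e]
    exact Finset.prod_congr rfl fun x _ => by rw [he]; ring
  rw [sq]
  nth_rewrite 2 [hflip]
  rw [← Finset.prod_mul_distrib]
  have : ∀ x : Qubits n, (1 - s * zSign hn x) * (1 + s * zSign hn x) = 1 - s ^ 2 := fun x => by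
    have h1 : zSign hn x ^ 2 = 1 := by rw [← sq_abs, abs_zSign, one_pow]
    linear_combination (-s ^ 2) * h1
  simp [this]

/-- The observable `U Z Uᴴ`. -/
noncomputable def rotatedZ {n : ℕ} (hn : 0 < n) (U : QubitUnitary n) : QubitOp n :=
  (U : QubitOp n) * pauliZLast hn * (U : QubitOp n)ᴴ

theorem continuous_qform_rotatedZ {n : ℕ} (hn : 0 < n) :
    Continuous fun p : QubitUnitary n × (Qubits n → ℂ) => qform (rotatedZ hn p.1) p.2 := by
  unfold qform rotatedZ
  refine Complex.continuous_re.comp (Continuous.dotProduct (by fun_prop)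
    (Continuous.matrix_mulVec ?_ continuous_snd))
  have h : Continuous fun p : QubitUnitary n × (Qubits n → ℂ) => (p.1 : QubitOp n) :=
    continuous_subtype_val.comp continuous_fst
  exact (h.matrix_mul continuous_const).matrix_mul h.matrix_conjTranspose

theorem qform_rotatedZ {n : ℕ} (hn : 0 < n) (U : QubitUnitary n) (z : Qubits n → ℂ) :
    qform (rotatedZ hn U) z = ∑ x, zSign hn x * ‖((U : QubitOp n)ᴴ *ᵥ z) x‖ ^ 2 := by
  rw [rotatedZ, qform_conj, pauliZLast_eq_diagonal, qform_diagonal]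

theorem abs_qform_rotatedZ_le {n : ℕ} (hn : 0 < n) (U : QubitUnitary n) (z : Qubits n → ℂ) :
    |qform (rotatedZ hn U) z| ≤ ∑ x, ‖z x‖ ^ 2 := by
  rw [qform_rotatedZ, ← sum_norm_sq_unitary_mulVec (Unitary.star_mem U.2) z]
  refine (Finset.abs_sum_le_sum_abs _ _).trans (Finset.sum_le_sum fun x _ => ?_)
  rw [abs_mul, abs_zSign, one_mul, abs_of_nonneg (sq_nonneg _), star_eq_conjTranspose]

/-- Only the norm of a vector matters for the law of the quadratic form of `U Z Uᴴ`. -/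
theorem lintegral_haar_qform_rotatedZ {n : ℕ} (hn : 0 < n) {φ : Qubits n → ℂ}
    (hφ : ∑ x, ‖φ x‖ ^ 2 = 1) (z : Qubits n → ℂ) (f : ℝ → ℝ≥0∞) :
    ∫⁻ U, f (qform (rotatedZ hn U) z) ∂haarUnitary n =
      ∫⁻ U, f ((∑ x, ‖z x‖ ^ 2) * qform (rotatedZ hn U) φ) ∂haarUnitary n := by
  set r := ∑ x, ‖z x‖ ^ 2 with hr
  have hr0 : 0 ≤ r := Finset.sum_nonneg fun x _ => sq_nonneg _
  have hB : ∃ B : QubitUnitary n, (B : QubitOp n) *ᵥ (Real.sqrt r • φ) = z := by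
    rcases hr0.eq_or_lt with h0 | hpos
    · refine ⟨1, ?_⟩
      have hz : ∀ x, z x = 0 := fun x => by
        have := (Finset.sum_eq_zero_iff_of_nonneg (fun x _ => sq_nonneg ‖z x‖)).1 (hr ▸ h0.symm) x
          (Finset.mem_univ x)
        simpa using this
      rw [← h0, Real.sqrt_zero, zero_smul, mulVec_zero]
      ext x; simp [hz x]
    · have hs : 0 < Real.sqrt r := Real.sqrt_pos.2 hpos
      obtain ⟨B, hB⟩ := exists_unitary_mulVec_eq (w := (Real.sqrt r)⁻¹ • z) hφ (by
        simp only [Pi.smul_apply, norm_smul, mul_pow, ← Finset.mul_sum, ← hr]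
        rw [norm_inv, Real.norm_of_nonneg hs.le, inv_pow, Real.sq_sqrt hr0,
          inv_mul_cancel₀ hpos.ne'])
      refine ⟨B, ?_⟩
      rw [mulVec_smul, hB, smul_smul, mul_inv_cancel₀ hs.ne', one_smul]
  obtain ⟨B, hB⟩ := hB
  rw [← lintegral_mul_left_eq_self (μ := haarUnitary n) _ B]
  refine lintegral_congr fun U => ?_
  congr 1
  have h1 : rotatedZ hn (B * U) = (B : QubitOp n) * rotatedZ hn U * (B : QubitOp n)ᴴ := by
    simp [rotatedZ, conjTranspose_mul, Matrix.mul_assoc]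
  rw [h1, qform_conj, ← hB, mulVec_mulVec, ← star_eq_conjTranspose,
    Matrix.mem_unitaryGroup_iff'.1 B.2, one_mulVec, qform_smul_vec, Real.sq_sqrt hr0]

/-- Integrating `exp (-‖z‖² + s ⟨z, U Z Uᴴ z⟩)` over Gaussian `z` and Haar-random `U` in the two
orders computes the average of `(1 - s ⟨φ, U Z Uᴴ φ⟩) ^ (-2 ^ n)`. -/
theorem lintegral_haar_inv_one_sub_pow {n : ℕ} (hn : 0 < n) {φ : Qubits n → ℂ}
    (hφ : ∑ x, ‖φ x‖ ^ 2 = 1) {s : ℝ} (hs : |s| < 1) :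
    ∫⁻ U, ENNReal.ofReal ((1 - s * qform (rotatedZ hn U) φ)⁻¹ ^ 2 ^ n) ∂haarUnitary n =
      ENNReal.ofReal (∏ x : Qubits n, (1 - s * zSign hn x))⁻¹ := by
  have hlt : ∀ y : ℝ, |y| ≤ 1 → 0 < 1 - s * y := fun y hy => by
    have : |s * y| < 1 := by
      rw [abs_mul]; exact (mul_le_of_le_one_right (abs_nonneg s) hy).trans_lt hs
    linarith [(abs_lt.1 this).2]
  have hX : ∀ U, |qform (rotatedZ hn U) φ| ≤ 1 := fun U => by
    simpa [hφ] using abs_qform_rotatedZ_le hn U φ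
  let F : QubitUnitary n → (Qubits n → ℂ) → ℝ≥0∞ := fun U z =>
    ENNReal.ofReal (Real.exp (-∑ x, ‖z x‖ ^ 2 + s * qform (rotatedZ hn U) z))
  have hF : Measurable (Function.uncurry F) := by
    have := continuous_qform_rotatedZ hn
    have hc : Continuous fun p : QubitUnitary n × (Qubits n → ℂ) =>
        Real.exp (-∑ x, ‖p.2 x‖ ^ 2 + s * qform (rotatedZ hn p.1) p.2) := by fun_prop
    exact hc.measurable.ennreal_ofReal
  have hswap := lintegral_lintegral_swap (μ := haarUnitary n)
    (ν := (volume : Measure (Qubits n → ℂ))) hF.aemeasurable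
  -- for a fixed unitary, substitute `z = U w`
  have h1 : ∀ U, ∫⁻ z, F U z =
      ENNReal.ofReal (Real.pi ^ 2 ^ n) *
        ENNReal.ofReal (∏ x : Qubits n, (1 - s * zSign hn x))⁻¹ := by
    intro U
    have hG := lintegral_exp_neg_sum_mul_norm_sq (fun x : Qubits n => 1 - s * zSign hn x)
      (fun x => hlt _ (abs_zSign hn x).le)
    have hm : Measurable fun z : Qubits n → ℂ =>
        ENNReal.ofReal (Real.exp (-∑ x, (1 - s * zSign hn x) * ‖z x‖ ^ 2)) := by fun_prop
    have hsub := (measurePreserving_unitary_mulVec (Unitary.star_mem U.2)).lintegral_comp hm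
    rw [hG] at hsub
    rw [← ENNReal.ofReal_mul (by positivity), ← Finset.prod_inv_distrib]
    rw [Finset.prod_div_distrib] at hsub
    simp only [Finset.prod_const, Finset.card_univ, Fintype.card_pi, Fintype.card_fin,
      div_eq_mul_inv] at hsub
    rw [Finset.prod_inv_distrib, ← hsub]
    refine lintegral_congr fun z => ?_
    simp only [F]
    rw [qform_rotatedZ, ← sum_norm_sq_unitary_mulVec (Unitary.star_mem U.2) z,
      star_eq_conjTranspose]
    congr 3
    rw [Finset.mul_sum, ← Finset.sum_neg_distrib, ← Finset.sum_neg_distrib,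
      ← Finset.sum_add_distrib]
    exact Finset.sum_congr rfl fun x _ => by ring
  -- for a fixed vector, replace it by a multiple of `φ`
  have h2 : ∀ z, ∫⁻ U, F U z ∂haarUnitary n = ∫⁻ U, ENNReal.ofReal
      (Real.exp (-∑ x, (1 - s * qform (rotatedZ hn U) φ) * ‖z x‖ ^ 2)) ∂haarUnitary n := by
    intro z
    rw [lintegral_haar_qform_rotatedZ hn hφ z
      (fun y => ENNReal.ofReal (Real.exp (-∑ x, ‖z x‖ ^ 2 + s * y)))]
    refine lintegral_congr fun U => ?_
    congr 2
    rw [← Finset.mul_sum]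
    ring
  have h3 : ∫⁻ z : Qubits n → ℂ, ∫⁻ U, F U z ∂haarUnitary n = ∫⁻ U,
      ENNReal.ofReal (Real.pi ^ 2 ^ n) *
        ENNReal.ofReal ((1 - s * qform (rotatedZ hn U) φ)⁻¹ ^ 2 ^ n) ∂haarUnitary n := by
    simp only [h2]
    rw [lintegral_lintegral_swap]
    · refine lintegral_congr fun U => ?_
      rw [lintegral_exp_neg_sum_mul_norm_sq (fun _ => 1 - s * qform (rotatedZ hn U) φ)
        (fun _ => hlt _ (hX U)), ← ENNReal.ofReal_mul (by positivity)]
      simp [div_eq_mul_inv, mul_pow]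
    · have hc : Continuous fun U : QubitUnitary n => qform (rotatedZ hn U) φ :=
        (continuous_qform_rotatedZ hn).comp (Continuous.prodMk continuous_id continuous_const)
      have : Continuous fun p : (Qubits n → ℂ) × QubitUnitary n => Real.exp
          (-∑ x, (1 - s * qform (rotatedZ hn p.2) φ) * ‖p.1 x‖ ^ 2) := by
        have := hc.comp (continuous_snd (X := Qubits n → ℂ))
        simp only [Function.comp_def] at this
        fun_prop
      exact this.measurable.ennreal_ofReal.aemeasurable
  simp only [h1, h3, lintegral_const, measure_univ, mul_one] at hswap
  rw [lintegral_const_mul'] at hswap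
  · refine ((ENNReal.mul_right_inj ?_ ENNReal.ofReal_ne_top).1 hswap).symm
    simp only [ne_eq, ENNReal.ofReal_eq_zero, not_le]
    exact pow_pos Real.pi_pos _
  · exact ENNReal.ofReal_ne_top

theorem continuous_qform_rotatedZ_left {n : ℕ} (hn : 0 < n) (φ : Qubits n → ℂ) :
    Continuous fun U : QubitUnitary n => qform (rotatedZ hn U) φ :=
  (continuous_qform_rotatedZ hn).comp (Continuous.prodMk continuous_id continuous_const)

/-- For a unit vector `φ` and a Haar-random `U` the number `⟨φ, U Z Uᴴ φ⟩` is subgaussian with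
variance proxy `4 / 2 ^ n`. -/
theorem integral_exp_mul_qform_rotatedZ_le {n : ℕ} (hn : 0 < n) {φ : Qubits n → ℂ}
    (hφ : ∑ x, ‖φ x‖ ^ 2 = 1) (t : ℝ) :
    ∫ U, Real.exp (t * qform (rotatedZ hn U) φ) ∂haarUnitary n ≤ Real.exp (2 * t ^ 2 / 2 ^ n) := by
  have hd : (0 : ℝ) < 2 ^ n := by positivity
  have hX : ∀ U, |qform (rotatedZ hn U) φ| ≤ 1 := fun U => by
    simpa [hφ] using abs_qform_rotatedZ_le hn U φ
  rcases le_or_gt (2 ^ n / 2) |t| with ht | ht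
  · -- for large `t` the bound `|X| ≤ 1` suffices
    have h1 : ∀ U, Real.exp (t * qform (rotatedZ hn U) φ) ≤ Real.exp (2 * t ^ 2 / 2 ^ n) := by
      intro U
      refine Real.exp_le_exp.2 ?_
      have h2 : t * qform (rotatedZ hn U) φ ≤ |t| := by
        refine (le_abs_self _).trans ?_
        rw [abs_mul]
        exact mul_le_of_le_one_right (abs_nonneg t) (hX U)
      refine h2.trans ?_
      rw [le_div_iff₀ hd, ← sq_abs t]
      nlinarith [abs_nonneg t]
    have h2 := integral_mono_of_nonneg (μ := haarUnitary n)
      (Filter.Eventually.of_forall fun U => (Real.exp_pos (t * qform (rotatedZ hn U) φ)).le)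
      (integrable_const (Real.exp (2 * t ^ 2 / 2 ^ n))) (Filter.Eventually.of_forall h1)
    simpa using h2
  · set s := t / 2 ^ n with hs
    have hs2 : |s| < 1 / 2 := by
      rw [hs, abs_div, abs_of_pos hd, div_lt_iff₀ hd]; linarith
    have hlt : ∀ y : ℝ, |y| ≤ 1 → 0 < 1 - s * y := fun y hy => by
      have : |s * y| < 1 / 2 := by
        rw [abs_mul]; exact (mul_le_of_le_one_right (abs_nonneg s) hy).trans_lt hs2
      linarith [(abs_lt.1 this).2]
    have hpt : ∀ U, Real.exp (t * qform (rotatedZ hn U) φ) ≤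
        (1 - s * qform (rotatedZ hn U) φ)⁻¹ ^ 2 ^ n := by
      intro U
      have ht' : t * qform (rotatedZ hn U) φ = (2 ^ n : ℕ) * (s * qform (rotatedZ hn U) φ) := by
        rw [hs]; push_cast; field_simp
      rw [ht', Real.exp_nat_mul]
      refine pow_le_pow_left₀ (Real.exp_pos _).le ?_ _
      rw [← neg_neg (s * _), Real.exp_neg]
      refine inv_anti₀ ?_ ?_
      · rw [neg_neg]; exact hlt _ (hX U)
      · rw [neg_neg]; linarith [Real.add_one_le_exp (-(s * qform (rotatedZ hn U) φ))]
    have hP : 0 < ∏ x : Qubits n, (1 - s * zSign hn x) :=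
      Finset.prod_pos fun x _ => hlt _ (abs_zSign hn x).le
    have hfin : (∏ x : Qubits n, (1 - s * zSign hn x))⁻¹ ≤ Real.exp (2 * t ^ 2 / 2 ^ n) := by
      rw [← inv_inv (Real.exp _), ← Real.exp_neg]
      refine inv_anti₀ (Real.exp_pos _) ?_
      refine (pow_le_pow_iff_left₀ (Real.exp_pos _).le hP.le two_ne_zero).1 ?_
      have hs4 : s ^ 2 ≤ 1 / 4 := by nlinarith [sq_abs s, abs_nonneg s]
      have he : Real.exp (-(2 * t ^ 2 / 2 ^ n)) ^ 2 = Real.exp (-(4 * s ^ 2)) ^ 2 ^ n := by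
        rw [← Real.exp_nat_mul, ← Real.exp_nat_mul, hs]
        congr 1
        push_cast
        field_simp
        ring
      rw [prod_one_sub_mul_zSign_sq, he]
      refine pow_le_pow_left₀ (Real.exp_pos _).le ?_ _
      rw [Real.exp_neg]
      refine (inv_anti₀ (by positivity) (Real.add_one_le_exp (4 * s ^ 2))).trans ?_
      rw [inv_le_iff_one_le_mul₀ (by positivity)]
      nlinarith [sq_nonneg s]
    rw [integral_eq_lintegral_of_nonneg_ae
      (Filter.Eventually.of_forall fun U => (Real.exp_pos _).le)
      ((continuous_qform_rotatedZ_left hn φ).const_mul t).rexp.aestronglyMeasurable]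
    refine ENNReal.toReal_le_of_le_ofReal (Real.exp_pos _).le ?_
    calc _ ≤ _ := lintegral_mono fun U => ENNReal.ofReal_le_ofReal (hpt U)
      _ = _ := lintegral_haar_inv_one_sub_pow hn hφ (hs2.trans (by norm_num))
      _ ≤ _ := ENNReal.ofReal_le_ofReal hfin

/-! ### Nets, and concentration for all states at once -/

/-- The unit sphere of a real normed space of dimension `k` has a `1/2`-net of `5 ^ k` points. -/
theorem exists_finset_half_net (E : Type*) [NormedAddCommGroup E] [NormedSpace ℝ E]
    [FiniteDimensional ℝ E] :
    ∃ s : Finset E, s.card ≤ 5 ^ Module.finrank ℝ E ∧ (∀ x ∈ s, ‖x‖ = 1) ∧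
      ∀ x : E, ‖x‖ = 1 → ∃ y ∈ s, ‖x - y‖ ≤ 1 / 2 := by
  classical
  let P : Finset E → Prop := fun s =>
    (∀ x ∈ s, ‖x‖ = 1) ∧ ∀ x ∈ s, ∀ y ∈ s, x ≠ y → 1 / 2 ≤ ‖x - y‖
  have hcard : ∀ s, P s → s.card ≤ 5 ^ Module.finrank ℝ E := by
    intro s hs
    have h2 : Function.Injective fun x : E => (2 : ℝ) • x := smul_right_injective E two_ne_zero
    rw [← Finset.card_image_of_injective s h2]
    refine Besicovitch.card_le_of_separated _ ?_ ?_
    · intro c hc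
      obtain ⟨x, hx, rfl⟩ := Finset.mem_image.1 hc
      simp [norm_smul, hs.1 x hx]
    · intro c hc d hd hcd
      obtain ⟨x, hx, rfl⟩ := Finset.mem_image.1 hc
      obtain ⟨y, hy, rfl⟩ := Finset.mem_image.1 hd
      have := hs.2 x hx y hy fun h => hcd (by rw [h])
      rw [← smul_sub, norm_smul, Real.norm_two]
      linarith
  -- a separated set of maximal cardinality is a net
  let C : Set ℕ := {k | ∃ s, P s ∧ s.card = k}
  have hC : C.Nonempty := ⟨0, ∅, by simp [P], rfl⟩
  have hbdd : BddAbove C := ⟨_, by rintro _ ⟨s, hs, rfl⟩; exact hcard s hs⟩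
  obtain ⟨s, hs, hmax⟩ := Nat.sSup_mem hC hbdd
  refine ⟨s, hcard s hs, hs.1, fun x hx => ?_⟩
  by_contra! hfar
  have hxs : x ∉ s := fun h => by
    have := hfar x h
    norm_num at this
  have hins : P (insert x s) := by
    refine ⟨fun y hy => ?_, fun y hy z hz hyz => ?_⟩
    · rcases Finset.mem_insert.1 hy with rfl | hy
      · exact hx
      · exact hs.1 y hy
    · rcases Finset.mem_insert.1 hy with hy | hy <;> rcases Finset.mem_insert.1 hz with hz | hz
      · exact absurd (hy.trans hz.symm) hyz
      · rw [hy]; exact (hfar z hz).le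
      · rw [hz, norm_sub_rev]; exact (hfar y hy).le
      · exact hs.2 y hy z hz hyz
  have := le_csSup hbdd ⟨_, hins, rfl⟩
  rw [Finset.card_insert_of_notMem hxs] at this
  omega

section OperatorFamily

variable {ι κ : Type*} [Fintype ι]

/-- The vector of all expectation values `Re ⟨z, A i z⟩` of a family of matrices. -/
noncomputable def qvec (A : κ → Matrix ι ι ℂ) (z : EuclideanSpace ℂ ι) : EuclideanSpace ℝ κ :=
  WithLp.toLp 2 fun i => qform (A i) z.ofLp

theorem norm_qvec_sq [Fintype κ] (A : κ → Matrix ι ι ℂ) (z : EuclideanSpace ℂ ι) :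
    ‖qvec A z‖ ^ 2 = ∑ i, qform (A i) z.ofLp ^ 2 := by
  simp [EuclideanSpace.norm_sq_eq, qvec]

theorem qvec_smul (A : κ → Matrix ι ι ℂ) (c : ℝ) (z : EuclideanSpace ℂ ι) :
    qvec A (c • z) = c ^ 2 • qvec A z := by
  ext i
  simp [qvec, qform_smul_vec]

theorem continuous_qvec (A : κ → Matrix ι ι ℂ) : Continuous (qvec A) :=
  (PiLp.continuous_toLp 2 _).comp (continuous_pi fun i =>
    (continuous_qform (A i)).comp (PiLp.continuous_ofLp 2 _))

/-- Polarization, with the two arguments scaled by `2` and `1/2`. -/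
theorem qvec_sub_qvec (A : κ → Matrix ι ι ℂ) (x y : EuclideanSpace ℂ ι) :
    qvec A x - qvec A y = (1 / 4 : ℝ) •
      (qvec A ((2 : ℝ) • (x - y) + (1 / 2 : ℝ) • (x + y)) -
        qvec A ((2 : ℝ) • (x - y) - (1 / 2 : ℝ) • (x + y))) := by
  ext i
  simp only [qvec, PiLp.sub_apply, PiLp.smul_apply, qform, WithLp.ofLp_add, WithLp.ofLp_sub,
    WithLp.ofLp_smul, smul_eq_mul, star_add, star_sub, star_smul, star_trivial, mulVec_add,
    mulVec_sub, mulVec_smul, add_dotProduct, sub_dotProduct, dotProduct_add, dotProduct_sub,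
    smul_dotProduct, dotProduct_smul, Complex.add_re, Complex.sub_re, Complex.smul_re]
  ring

/-- If the expectation values are bounded on a `1/2`-net of the unit sphere, then they are bounded
on the whole space: at a maximizer on the sphere, the value changes by at most the fraction
`31 / 32` of itself when one moves to a nearby point of the net. -/
theorem norm_qvec_le_of_net [Nonempty ι] [Fintype κ] (A : κ → Matrix ι ι ℂ)
    {s : Finset (EuclideanSpace ℂ ι)} (hs1 : ∀ x ∈ s, ‖x‖ = 1)
    (hs : ∀ x : EuclideanSpace ℂ ι, ‖x‖ = 1 → ∃ y ∈ s, ‖x - y‖ ≤ 1 / 2)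
    {b : ℝ} (hb : ∀ x ∈ s, ‖qvec A x‖ ≤ b) (z : EuclideanSpace ℂ ι) :
    ‖qvec A z‖ ≤ 32 * b * ‖z‖ ^ 2 := by
  obtain ⟨x₀, hx₀, hmax⟩ := (isCompact_sphere (0 : EuclideanSpace ℂ ι) 1).exists_isMaxOn
    (NormedSpace.sphere_nonempty.2 zero_le_one) (continuous_qvec A).norm.continuousOn
  rw [mem_sphere_zero_iff_norm] at hx₀
  set S := ‖qvec A x₀‖
  have hS : ∀ w, ‖qvec A w‖ ≤ S * ‖w‖ ^ 2 := by
    intro w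
    rcases eq_or_ne w 0 with rfl | hw
    · have := qvec_smul A 0 0
      simp only [zero_smul, ne_eq, OfNat.ofNat_ne_zero, not_false_eq_true, zero_pow] at this
      simp [this]
    · have hw' : ‖w‖ ≠ 0 := norm_ne_zero_iff.2 hw
      have h1 : ‖qvec A (‖w‖⁻¹ • w)‖ ≤ S := hmax (by simp [norm_smul, hw'])
      have h2 : w = ‖w‖ • (‖w‖⁻¹ • w) := by rw [smul_smul, mul_inv_cancel₀ hw', one_smul]
      have h3 : ‖qvec A w‖ = ‖w‖ ^ 2 * ‖qvec A (‖w‖⁻¹ • w)‖ := by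
        conv_lhs => rw [h2]
        rw [qvec_smul, norm_smul]; simp
      rw [h3, mul_comm]
      gcongr
  obtain ⟨y, hy, hxy⟩ := hs x₀ hx₀
  have hpar : ‖x₀ + y‖ ^ 2 = 4 - ‖x₀ - y‖ ^ 2 := by
    have := parallelogram_law_with_norm ℂ x₀ y
    rw [hx₀, hs1 y hy] at this
    linarith
  have hdiff : ‖qvec A x₀ - qvec A y‖ ≤ 31 / 32 * S := by
    rw [qvec_sub_qvec, norm_smul]
    set p := (2 : ℝ) • (x₀ - y)
    set q := (1 / 2 : ℝ) • (x₀ + y)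
    have h1 := parallelogram_law_with_norm ℂ p q
    have hp : ‖p‖ = 2 * ‖x₀ - y‖ := by simp [p, norm_smul]
    have hq : ‖q‖ = 1 / 2 * ‖x₀ + y‖ := by
      rw [norm_smul]; norm_num
    have h2 := norm_sub_le (qvec A (p + q)) (qvec A (p - q))
    have h3 := hS (p + q)
    have h4 := hS (p - q)
    have h5 : ‖p + q‖ ^ 2 + ‖p - q‖ ^ 2 ≤ 31 / 8 := by
      have : ‖x₀ - y‖ ^ 2 ≤ 1 / 4 := by nlinarith [norm_nonneg (x₀ - y)]
      rw [hp, hq] at h1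
      nlinarith
    have h6 : S * (‖p + q‖ ^ 2 + ‖p - q‖ ^ 2) ≤ S * (31 / 8) :=
      mul_le_mul_of_nonneg_left h5 (norm_nonneg _)
    have h7 : ‖(1 / 4 : ℝ)‖ = 1 / 4 := by norm_num
    rw [h7]
    linarith
  have hSb : S ≤ 32 * b := by
    have h1 := hb y hy
    have h2 := norm_sub_norm_le (qvec A x₀) (qvec A y)
    linarith
  exact (hS z).trans (by gcongr)

/-- A vector is at most twice its largest inner product with the points of a `1/2`-net. -/
theorem norm_le_two_mul_of_net {E : Type*} [NormedAddCommGroup E] [InnerProductSpace ℝ E]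
    {s : Finset E} (hs : ∀ x : E, ‖x‖ = 1 → ∃ y ∈ s, ‖x - y‖ ≤ 1 / 2)
    {v : E} {b : ℝ} (hb0 : 0 ≤ b) (hb : ∀ a ∈ s, inner ℝ a v ≤ b) : ‖v‖ ≤ 2 * b := by
  rcases eq_or_ne v 0 with rfl | hv
  · simpa using hb0
  · have hv' : ‖v‖ ≠ 0 := norm_ne_zero_iff.2 hv
    obtain ⟨a, ha, hda⟩ := hs (‖v‖⁻¹ • v) (by simp [norm_smul, hv'])
    have h1 : inner ℝ (‖v‖⁻¹ • v) v = ‖v‖ := by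
      rw [real_inner_smul_left, real_inner_self_eq_norm_sq]
      field_simp
    have h2 := real_inner_le_norm (‖v‖⁻¹ • v - a) v
    rw [inner_sub_left, h1] at h2
    have h3 := hb a ha
    have h4 : ‖‖v‖⁻¹ • v - a‖ * ‖v‖ ≤ 1 / 2 * ‖v‖ := by gcongr
    linarith

end OperatorFamily

section Concentration

/-- The product of the Haar measures, the law of `m` independent Haar-random unitaries. -/
noncomputable abbrev haarPi (n m : ℕ) : Measure (Fin m → QubitUnitary n) :=
  Measure.pi fun _ : Fin m => haarUnitary n

/-- The Chernoff bound for a fixed linear combination of the expectation values in a fixed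
state. -/
theorem haarPi_le_inner_qvec {n m : ℕ} (hn : 0 < n) {φ : EuclideanSpace ℂ (Qubits n)}
    (hφ : ‖φ‖ = 1) {a : EuclideanSpace ℝ (Fin m)} (ha : ‖a‖ = 1) {u : ℝ} (hu : 0 ≤ u) :
    (haarPi n m).real {U | u ≤ inner ℝ a (qvec (fun i => rotatedZ hn (U i)) φ)} ≤
      Real.exp (-(2 ^ n * u ^ 2 / 8)) := by
  have hφ' : ∑ x, ‖φ.ofLp x‖ ^ 2 = 1 := by rw [← EuclideanSpace.norm_sq_eq, hφ, one_pow]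
  have ha' : ∑ i, a i ^ 2 = 1 := by
    have := EuclideanSpace.norm_sq_eq a
    rw [ha] at this
    simpa using this.symm
  have hd : (0 : ℝ) < 2 ^ n := by positivity
  -- the optimal exponent for the variance proxy `4 / 2 ^ n`
  set t : ℝ := 2 ^ n * u / 4 with ht
  have hexp : ∀ U : Fin m → QubitUnitary n,
      Real.exp (t * inner ℝ a (qvec (fun i => rotatedZ hn (U i)) φ)) =
        ∏ i, Real.exp (t * a i * qform (rotatedZ hn (U i)) φ.ofLp) := by
    intro U
    rw [← Real.exp_sum, PiLp.inner_apply, Finset.mul_sum]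
    congr 1
    refine Finset.sum_congr rfl fun i _ => ?_
    simp [qvec]
    ring
  have hint : Integrable (fun U : Fin m → QubitUnitary n =>
      Real.exp (t * inner ℝ a (qvec (fun i => rotatedZ hn (U i)) φ))) (haarPi n m) := by
    simp only [hexp]
    refine Integrable.fintype_prod
      (f := fun i V => Real.exp (t * a i * qform (rotatedZ hn V) φ.ofLp)) fun i => ?_
    have hc := ((continuous_qform_rotatedZ_left hn φ.ofLp).const_mul (t * a i)).rexp
    exact hc.integrable_of_hasCompactSupport (HasCompactSupport.of_compactSpace _)
  refine (ProbabilityTheory.measure_ge_le_exp_mul_mgf u (t := t) (by positivity) hint).trans ?_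
  have hmgf : ProbabilityTheory.mgf (fun U : Fin m → QubitUnitary n =>
      inner ℝ a (qvec (fun i => rotatedZ hn (U i)) φ)) (haarPi n m) t ≤
        Real.exp (2 * t ^ 2 / 2 ^ n) := by
    simp only [ProbabilityTheory.mgf, hexp]
    rw [integral_fintype_prod_eq_prod
      (fun i V => Real.exp (t * a i * qform (rotatedZ hn V) φ.ofLp))]
    refine (Finset.prod_le_prod (fun i _ => integral_nonneg fun V => (Real.exp_pos _).le)
      (fun i _ => integral_exp_mul_qform_rotatedZ_le hn hφ' (t * a i))).trans_eq ?_
    rw [← Real.exp_sum]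
    congr 1
    rw [← Finset.sum_div]
    congr 1
    calc ∑ i, 2 * (t * a i) ^ 2 = 2 * t ^ 2 * ∑ i, a i ^ 2 := by
          rw [Finset.mul_sum]; exact Finset.sum_congr rfl fun i _ => by ring
      _ = 2 * t ^ 2 := by rw [ha', mul_one]
  refine (mul_le_mul_of_nonneg_left hmgf (Real.exp_pos _).le).trans_eq ?_
  rw [← Real.exp_add, ht]
  congr 1
  field_simp
  ring

/-- The unitaries for which no state sees too much of the observables: the squares of all
expectation values in a pure state sum to at most a constant times `1 + m / 2 ^ n`. -/
def spreadUnitaries {n : ℕ} (m : ℕ) (hn : 0 < n) : Set (Fin m → QubitUnitary n) :=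
  {U | ∀ z : EuclideanSpace ℂ (Qubits n), ‖qvec (fun i => rotatedZ hn (U i)) z‖ ^ 2 ≤
    163840 * ((2 ^ n + m) / 2 ^ n) * (‖z‖ ^ 2) ^ 2}

theorem measurableSet_spreadUnitaries {n : ℕ} (m : ℕ) (hn : 0 < n) :
    MeasurableSet (spreadUnitaries m hn) := by
  refine IsClosed.measurableSet ?_
  simp only [spreadUnitaries, Set.ofPred_forall, norm_qvec_sq]
  refine isClosed_iInter fun z => isClosed_le ?_ continuous_const
  exact continuous_finsetSum _ fun i _ =>
    ((continuous_qform_rotatedZ_left hn z.ofLp).comp (continuous_apply i)).pow 2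

/-- A union bound over nets of the unit spheres of `ℂ ^ (2 ^ n)` and `ℝ ^ m`. -/
theorem half_le_haarPi_spreadUnitaries {n : ℕ} (m : ℕ) (hn : 0 < n) :
    ENNReal.ofReal (1 / 2) ≤ haarPi n m (spreadUnitaries m hn) := by
  have hd : (0 : ℝ) < 2 ^ n := by positivity
  obtain ⟨s, hscard, hs1, hs⟩ := exists_finset_half_net (EuclideanSpace ℂ (Qubits n))
  obtain ⟨r, hrcard, hr1, hr⟩ := exists_finset_half_net (EuclideanSpace ℝ (Fin m))
  -- `u` makes the exponent in the Chernoff bound `-5 (2 ^ n + m)`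
  set u : ℝ := Real.sqrt (40 * ((2 ^ n + m) / 2 ^ n)) with hu
  have hu0 : 0 ≤ u := Real.sqrt_nonneg _
  have hu2 : u ^ 2 = 40 * ((2 ^ n + m) / 2 ^ n) := Real.sq_sqrt (by positivity)
  let bad : EuclideanSpace ℂ (Qubits n) × EuclideanSpace ℝ (Fin m) →
      Set (Fin m → QubitUnitary n) := fun p =>
    {U | u ≤ inner ℝ p.2 (qvec (fun i => rotatedZ hn (U i)) p.1)}
  have hsub : (spreadUnitaries m hn)ᶜ ⊆ ⋃ p ∈ s ×ˢ r, bad p := by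
    intro U hU
    by_contra hgood
    refine hU fun z => ?_
    have hgood' : ∀ x ∈ s, ∀ a ∈ r, inner ℝ a (qvec (fun i => rotatedZ hn (U i)) x) ≤ u := by
      intro x hx a ha
      by_contra! h
      refine hgood (Set.mem_iUnion₂.2 ⟨(x, a), Finset.mem_product.2 ⟨hx, ha⟩, h.le⟩)
    have h1 := norm_qvec_le_of_net (fun i => rotatedZ hn (U i)) hs1 hs
      (fun x hx => norm_le_two_mul_of_net hr hu0 (hgood' x hx)) z
    calc _ ≤ (32 * (2 * u) * ‖z‖ ^ 2) ^ 2 := pow_le_pow_left₀ (norm_nonneg _) h1 2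
      _ = 4096 * u ^ 2 * (‖z‖ ^ 2) ^ 2 := by ring
      _ = _ := by rw [hu2]; ring
  have hbad : ∀ p ∈ s ×ˢ r, (haarPi n m).real (bad p) ≤ Real.exp (-5) ^ (2 ^ n + m) := by
    intro p hp
    obtain ⟨h1, h2⟩ := Finset.mem_product.1 hp
    refine (haarPi_le_inner_qvec hn (hs1 _ h1) (hr1 _ h2) hu0).trans_eq ?_
    rw [← Real.exp_nat_mul, hu2]
    congr 1
    push_cast
    field_simp
    ring
  have hcard : ((s ×ˢ r).card : ℝ) ≤ 25 ^ (2 ^ n + m) := by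
    rw [finrank_real_of_complex, finrank_euclideanSpace, Fintype.card_pi] at hscard
    rw [finrank_euclideanSpace, Fintype.card_fin] at hrcard
    simp only [Fintype.card_fin, Finset.prod_const, Finset.card_univ] at hscard
    have h1 : (s ×ˢ r).card ≤ 25 ^ (2 ^ n + m) := by
      rw [Finset.card_product]
      calc s.card * r.card ≤ 5 ^ (2 * 2 ^ n) * 5 ^ m := Nat.mul_le_mul hscard hrcard
        _ ≤ 5 ^ (2 * 2 ^ n) * 25 ^ m :=
          Nat.mul_le_mul_left _ (Nat.pow_le_pow_left (by norm_num) m)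
        _ = 25 ^ (2 ^ n + m) := by rw [pow_mul, pow_add]; norm_num
    exact_mod_cast h1
  have hcompl : (haarPi n m).real (spreadUnitaries m hn)ᶜ ≤ 1 / 2 := by
    have he : Real.exp (-5) ≤ 1 / 50 := by
      rw [Real.exp_neg, one_div]
      refine inv_anti₀ (by norm_num) ?_
      have h1 : Real.exp 5 = Real.exp 1 ^ 5 := by rw [← Real.exp_nat_mul]; norm_num
      rw [h1]
      calc (50 : ℝ) ≤ 2.7 ^ 5 := by norm_num
        _ ≤ Real.exp 1 ^ 5 := pow_le_pow_left₀ (by norm_num)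
          (by linarith [Real.exp_one_gt_d9]) 5
    calc (haarPi n m).real (spreadUnitaries m hn)ᶜ
        ≤ (haarPi n m).real (⋃ p ∈ s ×ˢ r, bad p) := measureReal_mono hsub (measure_ne_top _ _)
      _ ≤ ∑ p ∈ s ×ˢ r, (haarPi n m).real (bad p) := measureReal_biUnion_finset_le _ _
      _ ≤ (s ×ˢ r).card • Real.exp (-5) ^ (2 ^ n + m) := Finset.sum_le_card_nsmul _ _ _ hbad
      _ ≤ 25 ^ (2 ^ n + m) * Real.exp (-5) ^ (2 ^ n + m) := by
        rw [nsmul_eq_mul]; gcongr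
      _ = (25 * Real.exp (-5)) ^ (2 ^ n + m) := (mul_pow _ _ _).symm
      _ ≤ (1 / 2) ^ (2 ^ n + m) := pow_le_pow_left₀ (by positivity) (by linarith) _
      _ ≤ 1 / 2 := pow_le_of_le_one (by norm_num) (by norm_num) (by positivity)
  rw [probReal_compl_eq_one_sub (measurableSet_spreadUnitaries m hn)] at hcompl
  rw [← ofReal_measureReal]
  exact ENNReal.ofReal_le_ofReal (by linarith)

end Concentration

/-! ### Traces, learners, and the two-point method -/

section Trace

variable {ι : Type*} [Fintype ι]

open scoped MatrixOrder Matrix.Norms.L2Operator in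
/-- A positive semidefinite matrix is a sum of rank-one matrices `z zᴴ`; here this is expressed
through the traces against other matrices. -/
theorem Matrix.PosSemidef.exists_re_trace_mul_eq_sum_qform [DecidableEq ι] {F : Matrix ι ι ℂ}
    (hF : F.PosSemidef) :
    ∃ z : ι → EuclideanSpace ℂ ι, ∀ A : Matrix ι ι ℂ,
      (F * A).trace.re = ∑ k, qform A (z k).ofLp := by
  obtain ⟨C, hC⟩ := CStarAlgebra.nonneg_iff_eq_star_mul_self.1 hF.nonneg
  refine ⟨fun k => WithLp.toLp 2 (star (C k)), fun A => ?_⟩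
  rw [hC, star_eq_conjTranspose, Matrix.mul_assoc, Matrix.trace_mul_comm, Matrix.trace,
    Complex.re_sum]
  refine Finset.sum_congr rfl fun k _ => ?_
  rw [Matrix.diag_apply, qform, star_star, Matrix.mul_assoc]
  rfl

theorem Matrix.PosSemidef.re_trace_mul_nonneg [DecidableEq ι] {F A : Matrix ι ι ℂ}
    (hF : F.PosSemidef) (hA : A.PosSemidef) : 0 ≤ (F * A).trace.re := by
  obtain ⟨z, hz⟩ := hF.exists_re_trace_mul_eq_sum_qform
  rw [hz]
  exact Finset.sum_nonneg fun k _ => (Complex.le_def.1 (hA.dotProduct_mulVec_nonneg _)).1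

/-- A bound on the expectation values in pure states extends to positive semidefinite matrices. -/
theorem sum_re_trace_mul_sq_le [DecidableEq ι] {κ : Type*} [Fintype κ] {A : κ → Matrix ι ι ℂ}
    {K : ℝ} (hK : 0 ≤ K)
    (h : ∀ z : EuclideanSpace ℂ ι, ‖qvec A z‖ ^ 2 ≤ K * (‖z‖ ^ 2) ^ 2)
    {F : Matrix ι ι ℂ} (hF : F.PosSemidef) :
    ∑ i, (F * A i).trace.re ^ 2 ≤ K * F.trace.re ^ 2 := by
  obtain ⟨z, hz⟩ := hF.exists_re_trace_mul_eq_sum_qform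
  have h1 : ∑ i, (F * A i).trace.re ^ 2 = ‖∑ k, qvec A (z k)‖ ^ 2 := by
    rw [EuclideanSpace.norm_sq_eq]
    refine Finset.sum_congr rfl fun i _ => ?_
    simp [hz, qvec]
  have h2 : F.trace.re = ∑ k, ‖z k‖ ^ 2 := by
    have := hz 1
    simpa only [mul_one, qform_one, ← EuclideanSpace.norm_sq_eq] using this
  have h3 : ‖∑ k, qvec A (z k)‖ ≤ Real.sqrt K * F.trace.re := by
    rw [h2, Finset.mul_sum]
    refine (norm_sum_le _ _).trans (Finset.sum_le_sum fun k _ => ?_)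
    refine abs_le_of_sq_le_sq' ?_ (by positivity) |>.2
    rw [mul_pow, Real.sq_sqrt hK]
    exact h (z k)
  rw [h1]
  calc _ ≤ (Real.sqrt K * F.trace.re) ^ 2 := pow_le_pow_left₀ (norm_nonneg _) h3 2
    _ = _ := by rw [mul_pow, Real.sq_sqrt hK]

end Trace

section Learner

variable {n : ℕ}

theorem POVM.prob_nonneg (F : POVM n) {ρ : QubitOp n} (hρ : IsQubitState ρ) (s : ℕ) :
    0 ≤ F.prob ρ s :=
  (F.posSemidef s).re_trace_mul_nonneg hρ.1

theorem POVM.hasSum_prob (F : POVM n) {ρ : QubitOp n} (hρ : IsQubitState ρ) :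
    HasSum (F.prob ρ) 1 := by
  let f : QubitOp n →+ ℝ :=
    { toFun := fun A => (A * ρ).trace.re
      map_zero' := by simp
      map_add' := fun A B => by simp [add_mul] }
  have hf : Continuous f := by
    change Continuous fun A : QubitOp n => (A * ρ).trace.re
    exact Complex.continuous_re.comp
      (Continuous.matrix_trace (Continuous.matrix_mul continuous_id continuous_const))
  have h := F.hasSum_one.map f hf
  have h1 : f 1 = 1 := by simp [f, hρ.2]
  rw [h1] at h
  exact h

variable {T : ℕ} {ι : Type}

theorem MemorylessLearner.nodeProb_nonneg (A : MemorylessLearner n T ι) {ρ : QubitOp n}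
    (hρ : IsQubitState ρ) (t : ℕ) (h : Fin t → ℕ) : 0 ≤ A.nodeProb ρ t h := by
  induction t with
  | zero => exact zero_le_one
  | succ t ih => exact mul_nonneg (ih _) (POVM.prob_nonneg _ hρ _)

theorem MemorylessLearner.tsum_nodeProb (A : MemorylessLearner n T ι) {ρ : QubitOp n}
    (hρ : IsQubitState ρ) (t : ℕ) : ∑' h, ENNReal.ofReal (A.nodeProb ρ t h) = 1 := by
  induction t with
  | zero => simp [MemorylessLearner.nodeProb]
  | succ t ih =>
    rw [← (Fin.snocEquiv fun _ : Fin (t + 1) => ℕ).tsum_eq, ENNReal.tsum_prod', ENNReal.tsum_comm]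
    have h1 : ∀ h : Fin t → ℕ, ∑' s, ENNReal.ofReal ((A.povm t h).prob ρ s) = 1 := fun h => by
      have hs := (A.povm t h).hasSum_prob hρ
      rw [← ENNReal.ofReal_tsum_of_nonneg (POVM.prob_nonneg _ hρ) hs.summable, hs.tsum_eq,
        ENNReal.ofReal_one]
    rw [← ih]
    refine tsum_congr fun h => ?_
    have h2 : ∀ s : ℕ, ENNReal.ofReal (A.nodeProb ρ (t + 1)
        (Fin.snocEquiv (fun _ : Fin (t + 1) => ℕ) (s, h))) =
          ENNReal.ofReal (A.nodeProb ρ t h) * ENNReal.ofReal ((A.povm t h).prob ρ s) := fun s => by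
      rw [← ENNReal.ofReal_mul (A.nodeProb_nonneg hρ t h)]
      have h3 : (Fin.snocEquiv (fun _ : Fin (t + 1) => ℕ) (s, h)) =
        (Fin.snoc h s : Fin (t + 1) → ℕ) := rfl
      rw [h3, MemorylessLearner.nodeProb, Fin.init_snoc, Fin.snoc_last]
    simp only [h2, ENNReal.tsum_mul_left, h1, mul_one]

/-- Le Cam's two-point method with one-sided likelihood ratios. The null state `ρ₀` has expectation
value `0` for all observables, and the alternative `ρ x` has the value `3 ε` for the observable
`O x`, so that no prediction is correct for both. If every sequence of outcomes is at least `r`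
times as likely under the uniform mixture of the alternatives as under the null state, then
`r ≤ 1 / 2`. -/
theorem MemorylessLearner.Predicts.likelihoodRatio_le [Fintype ι] [Nonempty ι]
    {A : MemorylessLearner n T ι} {O : ι → QubitOp n} {ε : ℝ} (hε : 0 < ε)
    (hA : A.Predicts O ε) {ρ₀ : QubitOp n} (hρ₀ : IsQubitState ρ₀) {ρ : ι → QubitOp n}
    (hρ : ∀ x, IsQubitState (ρ x)) (h₀ : ∀ x, (O x * ρ₀).trace.re = 0)
    (hx : ∀ x, (O x * ρ x).trace.re = 3 * ε) {r : ℝ} (hr : 0 ≤ r)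
    (hlr : ∀ h, r * A.nodeProb ρ₀ T h ≤
      ∑ x, (Fintype.card ι : ℝ)⁻¹ * A.nodeProb (ρ x) T h) : r ≤ 1 / 2 := by
  set w : ℝ := (Fintype.card ι : ℝ)⁻¹ with hw
  have hw0 : 0 ≤ w := by positivity
  set S₀ : Set (ι → ℝ) := {v | ∀ y, |v y - (O y * ρ₀).trace.re| ≤ ε} with hS₀
  let S : ι → Set (ι → ℝ) := fun x => {v | ∀ y, |v y - (O y * ρ x).trace.re| ≤ ε}
  let N : (Fin T → ℕ) → ℝ≥0∞ := fun h => (A.predict h : Measure (ι → ℝ)) S₀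
  have hdisj : ∀ x, Disjoint S₀ (S x) := fun x => by
    refine Set.disjoint_left.2 fun v hv hv' => ?_
    have h1 := hv x
    have h2 := hv' x
    rw [h₀, sub_zero] at h1
    rw [hx] at h2
    have h3 := abs_le.1 h1
    have h4 := abs_le.1 h2
    linarith [h3.2, h4.1]
  have hmeas : MeasurableSet S₀ := by
    rw [hS₀, Set.ofPred_forall]
    exact MeasurableSet.iInter fun y => measurableSet_le (by fun_prop) measurable_const
  have halt : ∀ x, ∑' h, ENNReal.ofReal (A.nodeProb (ρ x) T h) * N h ≤ 1 / 3 := by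
    intro x
    have h1 : ∑' h, ENNReal.ofReal (A.nodeProb (ρ x) T h) * N h + 2 / 3 ≤ 1 := by
      calc _ ≤ ∑' h, ENNReal.ofReal (A.nodeProb (ρ x) T h) * N h +
            ∑' h, ENNReal.ofReal (A.nodeProb (ρ x) T h) * (A.predict h : Measure (ι → ℝ)) (S x) :=
            add_le_add le_rfl (hA (ρ x) (hρ x))
        _ = ∑' h, ENNReal.ofReal (A.nodeProb (ρ x) T h) *
            (A.predict h : Measure (ι → ℝ)) (S₀ ∪ S x) := by
          rw [← ENNReal.tsum_add]
          refine tsum_congr fun h => ?_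
          rw [← mul_add, measure_union' (hdisj x) hmeas]
        _ ≤ ∑' h, ENNReal.ofReal (A.nodeProb (ρ x) T h) :=
          ENNReal.tsum_le_tsum fun h => mul_le_of_le_one_right' prob_le_one
        _ = 1 := A.tsum_nodeProb (hρ x) T
    have h2 : (1 : ℝ≥0∞) = 1 / 3 + 2 / 3 := by
      have h3 : (1 + 2 : ℝ≥0∞) = 3 := by norm_num
      rw [← ENNReal.add_div, h3, ENNReal.div_self (by norm_num) (by norm_num)]
    rw [h2] at h1
    exact (ENNReal.add_le_add_iff_right (by finiteness)).1 h1
  have hmix : ENNReal.ofReal r * (2 / 3) ≤ 1 / 3 := by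
    calc ENNReal.ofReal r * (2 / 3)
        ≤ ENNReal.ofReal r * ∑' h, ENNReal.ofReal (A.nodeProb ρ₀ T h) * N h :=
          mul_le_mul_right (hA ρ₀ hρ₀) _
      _ = ∑' h, ENNReal.ofReal (r * A.nodeProb ρ₀ T h) * N h := by
        rw [← ENNReal.tsum_mul_left]
        exact tsum_congr fun h => by rw [ENNReal.ofReal_mul hr, mul_assoc]
      _ ≤ ∑' h, ∑ x, ENNReal.ofReal w * (ENNReal.ofReal (A.nodeProb (ρ x) T h) * N h) := by
        refine ENNReal.tsum_le_tsum fun h => ?_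
        refine (mul_le_mul_left (ENNReal.ofReal_le_ofReal (hlr h)) _).trans_eq ?_
        rw [ENNReal.ofReal_sum_of_nonneg
          (fun x _ => mul_nonneg hw0 (A.nodeProb_nonneg (hρ x) T h)), Finset.sum_mul]
        exact Finset.sum_congr rfl fun x _ => by rw [ENNReal.ofReal_mul hw0, mul_assoc]
      _ = ∑ x, ENNReal.ofReal w * ∑' h, ENNReal.ofReal (A.nodeProb (ρ x) T h) * N h := by
        rw [Summable.tsum_finsetSum fun _ _ => ENNReal.summable]
        exact Finset.sum_congr rfl fun x _ => ENNReal.tsum_mul_left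
      _ ≤ ∑ _x : ι, ENNReal.ofReal w * (1 / 3) :=
        Finset.sum_le_sum fun x _ => mul_le_mul_right (halt x) _
      _ = 1 / 3 := by
        have hc : (Fintype.card ι : ℝ) ≠ 0 := by exact_mod_cast Fintype.card_ne_zero
        rw [Finset.sum_const, Finset.card_univ, nsmul_eq_mul, ← mul_assoc,
          ← ENNReal.ofReal_natCast, ← ENNReal.ofReal_mul (by positivity), hw,
          mul_inv_cancel₀ hc, ENNReal.ofReal_one, one_mul]
  have h1 := ENNReal.toReal_mono (by finiteness) hmix
  rw [ENNReal.toReal_mul, ENNReal.toReal_ofReal hr] at h1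
  norm_num at h1
  linarith

end Learner

/-! ### Tilted states and the likelihood ratio -/

section States

variable {n : ℕ}

theorem trace_rotatedZ (hn : 0 < n) (U : QubitUnitary n) : (rotatedZ hn U).trace = 0 := by
  rw [rotatedZ, Matrix.trace_mul_comm, ← Matrix.mul_assoc, ← star_eq_conjTranspose,
    Matrix.mem_unitaryGroup_iff'.1 U.2, Matrix.one_mul, pauliZLast_eq_diagonal,
    Matrix.trace_diagonal, ← Complex.ofReal_sum, sum_zSign, Complex.ofReal_zero]

theorem rotatedZ_mul_self (hn : 0 < n) (U : QubitUnitary n) :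
    rotatedZ hn U * rotatedZ hn U = 1 := by
  have hZ : pauliZLast hn * pauliZLast hn = 1 := by
    rw [pauliZLast_eq_diagonal, Matrix.diagonal_mul_diagonal, ← Matrix.diagonal_one]
    congr 1
    ext x
    rw [← Complex.ofReal_mul, ← abs_mul_abs_self, abs_zSign]
    simp
  calc rotatedZ hn U * rotatedZ hn U
      = U * pauliZLast hn * ((U : QubitOp n)ᴴ * U) * pauliZLast hn * (U : QubitOp n)ᴴ := by
        simp only [rotatedZ, Matrix.mul_assoc]
    _ = U * (pauliZLast hn * pauliZLast hn) * (U : QubitOp n)ᴴ := by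
        rw [← star_eq_conjTranspose, Matrix.mem_unitaryGroup_iff'.1 U.2, Matrix.mul_one]
        simp only [Matrix.mul_assoc]
    _ = 1 := by
        rw [hZ, Matrix.mul_one, ← star_eq_conjTranspose, Matrix.mem_unitaryGroup_iff.1 U.2]

/-- The maximally mixed state tilted by `c` in the direction of `U Z Uᴴ`. -/
noncomputable def tiltedState (hn : 0 < n) (U : QubitUnitary n) (c : ℝ) : QubitOp n :=
  ((2 ^ n : ℝ)⁻¹) • (1 + c • rotatedZ hn U)

theorem isQubitState_tiltedState (hn : 0 < n) (U : QubitUnitary n) {c : ℝ} (hc : |c| ≤ 1) :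
    IsQubitState (tiltedState hn U c) := by
  constructor
  · have h1 : (1 : QubitOp n) + c • rotatedZ hn U =
        U * Matrix.diagonal (fun x => ((1 + c * zSign hn x : ℝ) : ℂ)) * (U : QubitOp n)ᴴ := by
      have h2 : Matrix.diagonal (fun x => ((1 + c * zSign hn x : ℝ) : ℂ)) =
          1 + c • pauliZLast hn := by
        rw [pauliZLast_eq_diagonal, ← Matrix.diagonal_one, ← Matrix.diagonal_smul,
          Matrix.diagonal_add]
        congr 1
        ext x
        simp
      rw [h2, Matrix.mul_add, Matrix.add_mul, Matrix.mul_one, ← star_eq_conjTranspose,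
        Matrix.mem_unitaryGroup_iff.1 U.2, Matrix.mul_smul, Matrix.smul_mul, rotatedZ,
        star_eq_conjTranspose]
    rw [tiltedState, h1]
    refine Matrix.PosSemidef.smul ?_ (by positivity)
    refine Matrix.PosSemidef.mul_mul_conjTranspose_same (Matrix.PosSemidef.diagonal fun x => ?_) _
    have h3 : |c * zSign hn x| ≤ 1 := by rwa [abs_mul, abs_zSign, mul_one]
    have h4 : 0 ≤ 1 + c * zSign hn x := by linarith [(abs_le.1 h3).1]
    exact Complex.zero_le_real.2 h4
  · rw [tiltedState, Matrix.trace_smul, Matrix.trace_add, Matrix.trace_smul, trace_rotatedZ,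
      Matrix.trace_one]
    simp

theorem re_trace_mul_tiltedState (hn : 0 < n) (U : QubitUnitary n) (c : ℝ) (F : QubitOp n) :
    (F * tiltedState hn U c).trace.re =
      (2 ^ n : ℝ)⁻¹ * (F.trace.re + c * (F * rotatedZ hn U).trace.re) := by
  rw [tiltedState, Matrix.mul_smul, Matrix.mul_add, Matrix.mul_one, Matrix.mul_smul,
    Matrix.trace_smul, Matrix.trace_add, Matrix.trace_smul]
  simp only [Complex.smul_re, Complex.add_re, smul_eq_mul]

theorem re_trace_rotatedZ_mul_tiltedState (hn : 0 < n) (U : QubitUnitary n) (c : ℝ) :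
    (rotatedZ hn U * tiltedState hn U c).trace.re = c := by
  rw [re_trace_mul_tiltedState, trace_rotatedZ, rotatedZ_mul_self, Matrix.trace_one]
  have hre : ((Fintype.card (Qubits n) : ℂ)).re = 2 ^ n := by
    rw [Complex.natCast_re]; simp
  rw [Complex.zero_re, zero_add, hre]
  field_simp

/-- The alternative states: each of the observables `U i Z (U i)ᴴ` and their negatives has the
expectation value `3 * ε` in the state with the same index. -/
noncomputable def alternativeState {m : ℕ} (hn : 0 < n) (U : Fin m → QubitUnitary n) (ε : ℝ) :
    Fin m ⊕ Fin m → QubitOp n :=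
  Sum.elim (fun i => tiltedState hn (U i) (3 * ε)) (fun i => tiltedState hn (U i) (-(3 * ε)))

end States

section Likelihood

theorem exp_neg_five_mul_le_one_sub {y : ℝ} (h0 : 0 ≤ y) (h1 : y ≤ 4 / 5) :
    Real.exp (-(5 * y)) ≤ 1 - y := by
  rw [Real.exp_neg]
  refine (inv_anti₀ (by positivity) (Real.add_one_le_exp (5 * y))).trans ?_
  rw [inv_le_iff_one_le_mul₀ (by positivity)]
  nlinarith

/-- The geometric mean of the numbers `f ± a i` is close to `f` if the `a i` have a small
quadratic mean and stay away from `± f`. -/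
theorem mul_exp_neg_le_prod_rpow {m : ℕ} (hm : 0 < m) {f δ : ℝ} (hf : 0 ≤ f) (a : Fin m → ℝ)
    (ha : ∀ i, |a i| ≤ 0.87 * f) (hsum : ∑ i, a i ^ 2 ≤ δ * f ^ 2) :
    f * Real.exp (-(5 * δ / (2 * m))) ≤
      ∏ x : Fin m ⊕ Fin m, (Sum.elim (fun i => f + a i) (fun i => f - a i) x) ^ (2 * m : ℝ)⁻¹ := by
  have hnn : ∀ x : Fin m ⊕ Fin m, 0 ≤ Sum.elim (fun i => f + a i) (fun i => f - a i) x := by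
    rintro (i | i) <;> have h := abs_le.1 (ha i) <;> simp only [Sum.elim_inl, Sum.elim_inr] <;>
      linarith [h.1, h.2]
  rcases hf.eq_or_lt with rfl | hf
  · rw [zero_mul]
    exact Finset.prod_nonneg fun x _ => Real.rpow_nonneg (hnn x) _
  have hm' : (0 : ℝ) < 2 * m := by positivity
  rw [Real.finsetProd_rpow _ _ (fun x _ => hnn x),
    Real.le_rpow_inv_iff_of_pos (by positivity) (Finset.prod_nonneg fun x _ => hnn x) hm',
    Fintype.prod_sum_type, ← Finset.prod_mul_distrib]
  simp only [Sum.elim_inl, Sum.elim_inr]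
  have hpow : (f * Real.exp (-(5 * δ / (2 * m)))) ^ (2 * m : ℝ) =
      (∏ _i : Fin m, f ^ 2) * Real.exp (-(5 * δ)) := by
    rw [Real.mul_rpow hf.le (Real.exp_pos _).le, ← Real.exp_mul]
    congr 1
    · rw [Finset.prod_const, Finset.card_univ, Fintype.card_fin, ← pow_mul, ← Real.rpow_natCast]
      push_cast
      rfl
    · congr 1
      field_simp
  have hexp : Real.exp (-(5 * δ)) ≤ ∏ i, Real.exp (-(5 * (a i ^ 2 / f ^ 2))) := by
    rw [← Real.exp_sum]
    refine Real.exp_le_exp.2 ?_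
    rw [Finset.sum_neg_distrib, ← Finset.mul_sum, ← Finset.sum_div]
    have := (div_le_iff₀ (by positivity : (0 : ℝ) < f ^ 2)).2 hsum
    linarith
  rw [hpow]
  refine (mul_le_mul_of_nonneg_left hexp (by positivity)).trans ?_
  rw [← Finset.prod_mul_distrib]
  refine Finset.prod_le_prod (fun i _ => by positivity) fun i _ => ?_
  have hy : a i ^ 2 / f ^ 2 ≤ 4 / 5 := by
    rw [div_le_iff₀ (by positivity)]
    have := pow_le_pow_left₀ (abs_nonneg (a i)) (ha i) 2
    rw [sq_abs] at this
    nlinarith [sq_nonneg f]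
  calc f ^ 2 * Real.exp (-(5 * (a i ^ 2 / f ^ 2))) ≤ f ^ 2 * (1 - a i ^ 2 / f ^ 2) := by
        gcongr
        exact exp_neg_five_mul_le_one_sub (by positivity) hy
    _ = (f + a i) * (f - a i) := by field_simp; ring

variable {n m T : ℕ} {ι : Type}

/-- Along every path of the tree of a learner, the geometric mean of the likelihoods of the
alternatives loses at most a constant factor per measurement against the likelihood of the
maximally mixed state. -/
theorem MemorylessLearner.exp_neg_mul_nodeProb_le (A : MemorylessLearner n T ι) (hn : 0 < n)
    (hm : 0 < m) {U : Fin m → QubitUnitary n} {K : ℝ} (hK : 0 ≤ K)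
    (hU : ∀ z : EuclideanSpace ℂ (Qubits n),
      ‖qvec (fun i => rotatedZ hn (U i)) z‖ ^ 2 ≤ K * (‖z‖ ^ 2) ^ 2)
    {ε : ℝ} (hε : 0 < ε) (hε' : ε < 0.29) (V : QubitUnitary n) (t : ℕ) (h : Fin t → ℕ) :
    Real.exp (-(45 * ε ^ 2 * K / (2 * m) * t)) * A.nodeProb (tiltedState hn V 0) t h ≤
      ∏ x, (A.nodeProb (alternativeState hn U ε x) t h) ^ (2 * m : ℝ)⁻¹ := by
  have hstate : ∀ x, IsQubitState (alternativeState hn U ε x) := by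
    have h3 : |3 * ε| ≤ 1 := by rw [abs_of_pos (by positivity)]; linarith
    rintro (i | i)
    · exact isQubitState_tiltedState hn _ h3
    · exact isQubitState_tiltedState hn _ (by rwa [abs_neg])
  have hstate₀ : IsQubitState (tiltedState hn V 0) := isQubitState_tiltedState hn V (by simp)
  induction t with
  | zero => simp [MemorylessLearner.nodeProb]
  | succ t ih =>
    simp only [MemorylessLearner.nodeProb]
    set F := (A.povm t (Fin.init h)).elem (h (Fin.last t))
    have hF : F.PosSemidef := (A.povm t (Fin.init h)).posSemidef _
    set f : ℝ := (A.povm t (Fin.init h)).prob (tiltedState hn V 0) (h (Fin.last t)) with hf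
    have hf' : f = (2 ^ n : ℝ)⁻¹ * F.trace.re := by
      rw [hf, POVM.prob, re_trace_mul_tiltedState]; simp [F]
    let a : Fin m → ℝ := fun i => (2 ^ n : ℝ)⁻¹ * (3 * ε * (F * rotatedZ hn (U i)).trace.re)
    have hprob : ∀ x, (A.povm t (Fin.init h)).prob (alternativeState hn U ε x) (h (Fin.last t)) =
        Sum.elim (fun i => f + a i) (fun i => f - a i) x := by
      rintro (i | i) <;>
        simp only [alternativeState, Sum.elim_inl, Sum.elim_inr, POVM.prob,
          re_trace_mul_tiltedState, hf', a, F] <;> ring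
    -- testing the positivity of the tilted states with `± 1` bounds the expectation values
    have habs : ∀ i, |(F * rotatedZ hn (U i)).trace.re| ≤ F.trace.re := by
      intro i
      have hd : (0 : ℝ) < (2 ^ n : ℝ)⁻¹ := by positivity
      have h1 := hF.re_trace_mul_nonneg
        (isQubitState_tiltedState hn (U i) (c := 1) (by simp)).1
      have h2 := hF.re_trace_mul_nonneg
        (isQubitState_tiltedState hn (U i) (c := -1) (by simp)).1
      rw [re_trace_mul_tiltedState, mul_nonneg_iff_of_pos_left hd] at h1 h2
      exact abs_le.2 ⟨by linarith, by linarith⟩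
    have ha : ∀ i, |a i| ≤ 0.87 * f := by
      intro i
      have hTr : 0 ≤ F.trace.re := (abs_nonneg _).trans (habs i)
      calc |a i| = (2 ^ n : ℝ)⁻¹ * (3 * ε * |(F * rotatedZ hn (U i)).trace.re|) := by
            rw [abs_mul, abs_mul, abs_of_pos (by positivity : (0 : ℝ) < (2 ^ n : ℝ)⁻¹),
              abs_of_pos (by positivity : 0 < 3 * ε)]
        _ ≤ (2 ^ n : ℝ)⁻¹ * (0.87 * F.trace.re) := by
            gcongr
            · linarith
            · exact habs i
        _ = 0.87 * f := by rw [hf']; ring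
    have hsum : ∑ i, a i ^ 2 ≤ 9 * ε ^ 2 * K * f ^ 2 := by
      have h1 := sum_re_trace_mul_sq_le hK hU hF
      calc ∑ i, a i ^ 2
          = ((2 ^ n : ℝ)⁻¹ ^ 2 * (9 * ε ^ 2)) * ∑ i, (F * rotatedZ hn (U i)).trace.re ^ 2 := by
            rw [Finset.mul_sum]
            exact Finset.sum_congr rfl fun i _ => by simp only [a]; ring
        _ ≤ ((2 ^ n : ℝ)⁻¹ ^ 2 * (9 * ε ^ 2)) * (K * F.trace.re ^ 2) := by gcongr
        _ = _ := by rw [hf']; ring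
    have hstep := mul_exp_neg_le_prod_rpow hm (POVM.prob_nonneg _ hstate₀ _ : 0 ≤ f) a ha hsum
    have hsplit : Real.exp (-(45 * ε ^ 2 * K / (2 * m) * ((t + 1 : ℕ) : ℝ))) =
        Real.exp (-(45 * ε ^ 2 * K / (2 * m) * t)) *
          Real.exp (-(5 * (9 * ε ^ 2 * K) / (2 * m))) := by
      rw [← Real.exp_add]
      congr 1
      push_cast
      ring
    calc _ = (Real.exp (-(45 * ε ^ 2 * K / (2 * m) * t)) *
            A.nodeProb (tiltedState hn V 0) t (Fin.init h)) *
          (f * Real.exp (-(5 * (9 * ε ^ 2 * K) / (2 * m)))) := by rw [hsplit]; ring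
      _ ≤ _ := mul_le_mul (ih _) hstep
          (mul_nonneg (POVM.prob_nonneg _ hstate₀ _) (Real.exp_pos _).le)
          (Finset.prod_nonneg fun x _ => Real.rpow_nonneg (A.nodeProb_nonneg (hstate x) _ _) _)
      _ = _ := by
        rw [← Finset.prod_mul_distrib]
        refine Finset.prod_congr rfl fun x _ => ?_
        rw [hprob, Real.mul_rpow (A.nodeProb_nonneg (hstate x) _ _)]
        rw [← hprob]
        exact POVM.prob_nonneg _ (hstate x) _

/-- A bound on the expectation values in pure states gives a lower bound on the number of
copies. -/
theorem log_two_le_of_predicts (hn : 0 < n) (hm : 0 < m) {U : Fin m → QubitUnitary n} {K : ℝ}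
    (hK : 0 ≤ K) (hU : ∀ z : EuclideanSpace ℂ (Qubits n),
      ‖qvec (fun i => rotatedZ hn (U i)) z‖ ^ 2 ≤ K * (‖z‖ ^ 2) ^ 2)
    {ε : ℝ} (hε : 0 < ε) (hε' : ε < 0.29) (A : MemorylessLearner n T (Fin m ⊕ Fin m))
    (hA : A.Predicts (signedObservables hn U) ε) :
    Real.log 2 ≤ 45 * ε ^ 2 * K / (2 * m) * T := by
  have hne : Nonempty (Fin m ⊕ Fin m) := ⟨Sum.inl ⟨0, hm⟩⟩
  have hm' : (0 : ℝ) < 2 * m := by positivity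
  have h3 : |3 * ε| ≤ 1 := by rw [abs_of_pos (by positivity)]; linarith
  have hstate : ∀ x, IsQubitState (alternativeState hn U ε x) := by
    rintro (i | i)
    · exact isQubitState_tiltedState hn _ h3
    · exact isQubitState_tiltedState hn _ (by rwa [abs_neg])
  have hcard : (Fintype.card (Fin m ⊕ Fin m) : ℝ) = 2 * m := by
    rw [Fintype.card_sum, Fintype.card_fin]; push_cast; ring
  have hO : ∀ i, signedObservables hn U (Sum.inl i) = rotatedZ hn (U i) := fun i => rfl
  have hO' : ∀ i, signedObservables hn U (Sum.inr i) = -rotatedZ hn (U i) := fun i => rfl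
  have hle := hA.likelihoodRatio_le hε
    (isQubitState_tiltedState hn 1 (c := 0) (by simp)) hstate
    (by rintro (i | i) <;> simp [hO, hO', re_trace_mul_tiltedState, trace_rotatedZ])
    (by
      rintro (i | i)
      · rw [hO]; exact re_trace_rotatedZ_mul_tiltedState hn (U i) (3 * ε)
      · rw [hO', Matrix.neg_mul, Matrix.trace_neg, Complex.neg_re]
        have h := re_trace_rotatedZ_mul_tiltedState hn (U i) (-(3 * ε))
        simp only [alternativeState, Sum.elim_inr]
        rw [h, neg_neg])
    (r := Real.exp (-(45 * ε ^ 2 * K / (2 * m) * T))) (Real.exp_pos _).le (by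
      intro h
      refine (A.exp_neg_mul_nodeProb_le hn hm hK hU hε hε' 1 T h).trans ?_
      rw [← hcard]
      refine Real.geom_mean_le_arith_mean_weighted _ _ _ (fun x _ => by positivity) ?_
        fun x _ => A.nodeProb_nonneg (hstate x) T h
      rw [Finset.sum_const, Finset.card_univ, nsmul_eq_mul, hcard, mul_inv_cancel₀ hm'.ne'])
  have h1 := Real.log_le_log (Real.exp_pos _) hle
  rw [Real.log_exp, one_div, Real.log_inv] at h1
  linarith

end Likelihood

/-! ### The lower bound -/

theorem mainTheorem1 :
    ∃ p : ℝ, 0 < p ∧ ∃ c : ℝ, 0 < c ∧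
      ∀ (n m : ℕ) (hn : 0 < n), 0 < m →
        ∃ G : Set (Fin m → QubitUnitary n), MeasurableSet G ∧
          ENNReal.ofReal p ≤ Measure.pi (fun _ : Fin m => haarUnitary n) G ∧
          ∀ U ∈ G, ∀ ε : ℝ, 0 < ε → ε < 0.29 →
            ∀ (T : ℕ) (A : MemorylessLearner n T (Fin m ⊕ Fin m)),
              A.Predicts (signedObservables hn U) ε →
                c * (min ((2 * m : ℝ) / Real.log (2 * m)) (2 ^ n) / ε ^ 2) ≤ (T : ℝ) := by
  refine ⟨1 / 2, by norm_num, (45 * 163840 * 5)⁻¹, by norm_num, fun n m hn hm => ?_⟩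
  refine ⟨spreadUnitaries m hn, measurableSet_spreadUnitaries m hn,
    half_le_haarPi_spreadUnitaries m hn, fun U hU ε hε hε' T A hA => ?_⟩
  have hlog := log_two_le_of_predicts hn hm (by positivity) hU hε hε' A hA
  have hm1 : (1 : ℝ) ≤ m := by exact_mod_cast hm
  have hd : (0 : ℝ) < 2 ^ n := by positivity
  have hlog2 : (1 / 2 : ℝ) ≤ Real.log 2 := by linarith [Real.log_two_gt_d9]
  have hlogm : Real.log 2 ≤ Real.log (2 * m) := Real.log_le_log two_pos (by linarith)
  -- `1 / log (2 m) ≤ 2`, and the harmonic mean of `m` and `2 ^ n` dominates their minimum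
  set μ := min ((2 * m : ℝ) / Real.log (2 * m)) (2 ^ n) with hμ
  have h1 : μ ≤ 4 * m := by
    refine (min_le_left _ _).trans ?_
    rw [div_le_iff₀ (by linarith)]
    nlinarith
  have h2 : μ ≤ 2 ^ n := min_le_right _ _
  have h3 : 0 ≤ μ := le_min (div_nonneg (by positivity) (by linarith)) hd.le
  have h4 : μ * (2 ^ n + m) ≤ 5 * (m * 2 ^ n) := by nlinarith
  have h5 : Real.log 2 * (2 * m * 2 ^ n) ≤ 45 * 163840 * ε ^ 2 * (2 ^ n + m) * T := by
    have h6 := mul_le_mul_of_nonneg_right hlog (by positivity : (0 : ℝ) ≤ 2 * m * 2 ^ n)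
    refine h6.trans_eq ?_
    field_simp
  have h7 : μ ≤ 45 * 163840 * 5 * ε ^ 2 * T := by
    have hpos : (0 : ℝ) < 2 ^ n + m := by positivity
    refine le_of_mul_le_mul_right ?_ hpos
    have h8 : (m * 2 ^ n : ℝ) ≤ Real.log 2 * (2 * m * 2 ^ n) := by
      have := mul_le_mul_of_nonneg_right hlog2 (by positivity : (0 : ℝ) ≤ 2 * m * 2 ^ n)
      linarith
    linarith
  rw [inv_mul_le_iff₀ (by norm_num), div_le_iff₀ (by positivity)]
  linarith
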